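/- Let $M\subset\mathbb{C}^d$ be a bounded, connected, embedded complex submanifold. Let $\mathsf{k}_M$ be its Kobayashi distance (the infimum of lengths of chains of holomorphic discs, with the Poincaré distance of $|dz|/(1-|z|^2)$ on the unit disc $\mathbb{D}$), let $\kappa_M(z,X)=\inf\{|v| : v\in\mathbb{C},\ \varphi:\mathbb{D}\to M \text{ holomorphic},\ \varphi(0)=z,\ \varphi'(0)v=X\}$ be its Kobayashi--Royden pseudometric, and let $\partial M=\overline{M}\setminus M$. Suppose that $(M,\mathsf{k}_M)$ is Cauchy complete. A real Kobayashi geodesic is a map $\sigma:[a,b]\to M$ with $\mathsf{k}_M(\sigma(s),\sigma(t))=|s-t|$ for all $s,t\in[a,b]$. For $\lambda\ge 1$ and $\kappa\ge 0$, a $(\lambda,\kappa)$-almost-geodesic is an absolutely continuous curve $\sigma:[a,b]\to M$ such that $\frac1\lambda|t-s|-\kappa\le \mathsf{k}_M(\sigma(t),\sigma(s))\le\lambda|t-s|+\kappa$ for all $s,t\in[a,b]$ and $\kappa_M(\sigma(t),\sigma'(t))\le\lambda$ for almost every $t\in[a,b]$. A class of curves $[a,b]\to M$ satisfies the visibility condition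 if for all $p\ne q$ in $\partial M$ there are $\mathbb{C}^d$-neighbourhoods $V$ of $p$ and $W$ of $q$ with $\overline V\cap\overline W=\emptyset$ and a compact set $K\subset M$ such that every curve of the class with initial point in $V$ and terminal point in $W$ meets $K$. $M$ is a BNT-visibility submanifold if $(M,\mathsf{k}_M)$ is Cauchy complete and the real Kobayashi geodesics satisfy the visibility condition. For $\kappa>0$, $M$ is a $(1,\kappa)$-visibility submanifold if any two distinct points of $M$ can be joined by a $(1,\kappa)$-almost-geodesic and the $(1,\kappa)$-almost-geodesics satisfy the visibility condition; for $\kappa=0$, $M$ is a $(1,0)$-visibility submanifold if the $(1,0)$-almost-geodesics satisfy the visibility condition. Then $M$ is a BNT-visibility submanifold if and only if $M$ is a $(1,\kappa)$-visibility submanifold for all $\kappa\ge 0$. -/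

import Mathlib

open Set Filter Topology MeasureTheory
open scoped ENNReal

noncomputable section

/-- Complex Euclidean space `ℂ^d` with its Euclidean norm. -/
abbrev CSpace (d : ℕ) : Type := EuclideanSpace ℂ (Fin d)

/-- The open unit disc in `ℂ`. -/
def unitDisc : Set ℂ := Metric.ball 0 1

/-- `M ⊆ ℂ^d` is an embedded complex submanifold (of some dimension `n`): near each of its points,
a biholomorphic change of coordinates of `ℂ^d` carries `M` to an `n`-dimensional complex linear
subspace. -/
def IsEmbeddedComplexSubmanifold {d : ℕ} (M : Set (CSpace d)) : Prop :=
  ∃ n : ℕ, ∀ p ∈ M, ∃ (Φ : OpenPartialHomeomorph (CSpace d) (CSpace d))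
    (L : Submodule ℂ (CSpace d)),
      p ∈ Φ.source ∧
      DifferentiableOn ℂ Φ Φ.source ∧
      DifferentiableOn ℂ Φ.symm Φ.target ∧
      Module.finrank ℂ L = n ∧
      ∀ x ∈ Φ.source, x ∈ M ↔ Φ x ∈ L

/-- A holomorphic map from the unit disc to `M`. As `M` is embedded, this is a
`ℂ^d`-valued holomorphic map whose image lies in `M`. -/
def IsHolomorphicDisc {d : ℕ} (M : Set (CSpace d)) (φ : ℂ → CSpace d) : Prop :=
  DifferentiableOn ℂ φ unitDisc ∧ MapsTo φ unitDisc M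

/-- The Poincaré distance on the unit disc, the integrated form of `|dz| / (1 - |z|^2)`. -/
def poincareDist (a b : ℂ) : ℝ :=
  Real.artanh (‖a - b‖ / ‖1 - (starRingEnd ℂ) b * a‖)

/-- `c` is the length of a finite chain of holomorphic discs in `M` from `z` to `w`: there are
points `z = p 0, …, p m = w` of `M`, discs `φ i` in `M` and points `a i`, `b i` of the unit disc
with `φ i (a i) = p i` and `φ i (b i) = p (i + 1)`, and `c` is the sum of the Poincaré distances
between `a i` and `b i`. -/
def IsChainLength {d : ℕ} (M : Set (CSpace d)) (z w : CSpace d) (c : ℝ) : Prop :=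
  ∃ (m : ℕ) (p : ℕ → CSpace d) (φ : ℕ → ℂ → CSpace d) (a b : ℕ → ℂ),
    p 0 = z ∧ p m = w ∧
    (∀ i < m, IsHolomorphicDisc M (φ i) ∧ a i ∈ unitDisc ∧ b i ∈ unitDisc ∧
      φ i (a i) = p i ∧ φ i (b i) = p (i + 1)) ∧
    c = ∑ i ∈ Finset.range m, poincareDist (a i) (b i)

/-- The Kobayashi distance `k_M` (meant for `z, w` in a connected complex submanifold `M`, where
any two points are joined by a chain of holomorphic discs). -/
def kobayashiDist {d : ℕ} (M : Set (CSpace d)) (z w : CSpace d) : ℝ :=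
  sInf {c : ℝ | IsChainLength M z w c}

/-- The Kobayashi--Royden pseudometric `κ_M(z, X)`: the infimum of `|v|` over all `v ∈ ℂ` for which
some holomorphic disc `φ` in `M` satisfies `φ 0 = z` and `φ'(0) v = X`
(it is `∞` if `X` is not tangent to `M` at `z`). -/
def kobayashiRoyden {d : ℕ} (M : Set (CSpace d)) (z X : CSpace d) : ℝ≥0∞ :=
  ⨅ (v : ℂ) (_ : ∃ φ : ℂ → CSpace d, IsHolomorphicDisc M φ ∧ φ 0 = z ∧ v • deriv φ 0 = X),
    ENNReal.ofReal ‖v‖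

/-- `(M, k_M)` is Cauchy complete. -/
def IsKobayashiComplete {d : ℕ} (M : Set (CSpace d)) : Prop :=
  ∀ u : ℕ → CSpace d, (∀ n, u n ∈ M) →
    (∀ ε > 0, ∃ N, ∀ m ≥ N, ∀ n ≥ N, kobayashiDist M (u m) (u n) < ε) →
    ∃ z ∈ M, Tendsto (fun n => kobayashiDist M (u n) z) atTop (𝓝 0)

/-- `σ : [a, b] → M` is a real Kobayashi geodesic, i.e. an isometry into `(M, k_M)`. -/
structure IsRealKobayashiGeodesic {d : ℕ} (M : Set (CSpace d)) (a b : ℝ)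
    (σ : ℝ → CSpace d) : Prop where
  le : a ≤ b
  mapsTo : MapsTo σ (Icc a b) M
  isometry : ∀ s ∈ Icc a b, ∀ t ∈ Icc a b, |s - t| = kobayashiDist M (σ s) (σ t)

/-- `σ : [a, b] → M` is a `(lam, kap)`-almost-geodesic. -/
structure IsAlmostGeodesic {d : ℕ} (M : Set (CSpace d)) (lam kap : ℝ) (a b : ℝ)
    (σ : ℝ → CSpace d) : Prop where
  le : a ≤ b
  mapsTo : MapsTo σ (Icc a b) M
  lower : ∀ s ∈ Icc a b, ∀ t ∈ Icc a b,
    (1 / lam) * |t - s| - kap ≤ kobayashiDist M (σ t) (σ s)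
  upper : ∀ s ∈ Icc a b, ∀ t ∈ Icc a b,
    kobayashiDist M (σ t) (σ s) ≤ lam * |t - s| + kap
  absolutelyContinuous : AbsolutelyContinuousOnInterval σ a b
  speed : ∀ᵐ t ∂(volume.restrict (Icc a b)),
    kobayashiRoyden M (σ t) (deriv σ t) ≤ ENNReal.ofReal lam

/-- The visibility condition for a class `Γ` of curves (`Γ a b σ` says that `σ` restricted to
`[a, b]` belongs to the class): for all distinct points `p, q` of `∂M = closure M \ M` there are
neighbourhoods `V`, `W` of `p`, `q` with disjoint closures and a compact subset `K` of `M` that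
meets every curve of the class which starts in `V` and ends in `W`. -/
def BendsInside {d : ℕ} (M : Set (CSpace d)) (Γ : ℝ → ℝ → (ℝ → CSpace d) → Prop) : Prop :=
  ∀ p ∈ closure M \ M, ∀ q ∈ closure M \ M, p ≠ q →
    ∃ V ∈ 𝓝 p, ∃ W ∈ 𝓝 q, ∃ K : Set (CSpace d),
      closure V ∩ closure W = ∅ ∧ IsCompact K ∧ K ⊆ M ∧
      ∀ (a b : ℝ) (σ : ℝ → CSpace d), Γ a b σ → σ a ∈ V → σ b ∈ W →
        ∃ t ∈ Icc a b, σ t ∈ K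

/-- Any two distinct points of `M` can be joined by a `(lam, kap)`-almost-geodesic. -/
def JoinedByAlmostGeodesics {d : ℕ} (M : Set (CSpace d)) (lam kap : ℝ) : Prop :=
  ∀ z ∈ M, ∀ w ∈ M, z ≠ w →
    ∃ (a b : ℝ) (σ : ℝ → CSpace d), IsAlmostGeodesic M lam kap a b σ ∧ σ a = z ∧ σ b = w

/-- `M` has the visibility property with respect to `(lam, kap)`-almost-geodesics. For `kap > 0`
this comprises both the existence of almost-geodesics and the visibility condition. For `kap = 0`
it is the visibility condition alone: in a complete `M`, real geodesics need not be
`(1, 0)`-almost-geodesics, since `κ_M(z, ·)` need not be convex. -/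
def IsVisibilitySubmanifold {d : ℕ} (M : Set (CSpace d)) (lam kap : ℝ) : Prop :=
  (0 < kap → JoinedByAlmostGeodesics M lam kap) ∧
  BendsInside M (IsAlmostGeodesic M lam kap)

/-- `M` is a BNT-visibility submanifold. -/
def IsBNTVisibilitySubmanifold {d : ℕ} (M : Set (CSpace d)) : Prop :=
  IsKobayashiComplete M ∧ BendsInside M (IsRealKobayashiGeodesic M)

end

/-!
Let `(x | y)_o` be the Gromov product of the metric `k_M`. Real geodesics and
`(1, κ)`-almost-geodesics are all almost minimizing: the triangle inequality between the endpoints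
and any intermediate point is an equality up to a constant. For a class of almost minimizing curves
that joins any two points, visibility is equivalent to boundedness of `(x | y)_o` as `x` and `y`
tend to distinct points of `∂M`, and this condition does not involve the class.

If a curve of the class from `x` to `y` meets a fixed compact set, then `(x | y)_o` is bounded.
Conversely, since the closure of `M` is compact and no boundary point is close to both `p` and `q`,
boundedness gives `min (x | z)_o (z | y)_o ≤ C` for all `z` and all `x`, `y` close to `p`, `q`. On
an almost minimizing curve from `x` to `y` this fails at a point as far from `x` as `o` is, unless
that point is within bounded distance of `o`; and bounded sets are relatively compact because
`(M, k_M)` is a complete locally compact length space (Hopf–Rinow). The same theorem provides real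
geodesics, and concatenated geodesics of discs provide `(1, κ)`-almost-geodesics for `κ > 0`.
-/

section LengthSpace

variable {X : Type*}

lemma lipschitzWith_one_iff_dist_le_sub [PseudoMetricSpace X] {γ : ℝ → X} :
    LipschitzWith 1 γ ↔ ∀ ⦃s t⦄, s ≤ t → dist (γ s) (γ t) ≤ t - s := by
  refine ⟨fun h s t hst => ?_, fun h => LipschitzWith.mk_one fun s t => ?_⟩
  · simpa [dist_comm s t, Real.dist_eq, abs_of_nonneg (sub_nonneg.2 hst)] using h.dist_le_mul s t
  · wlog hst : s ≤ t generalizing s t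
    · rw [dist_comm, dist_comm s]
      exact this t s (le_of_not_ge hst)
    rw [dist_comm s, Real.dist_eq, abs_of_nonneg (sub_nonneg.2 hst)]
    exact h hst

lemma abs_sub_sub_le_dist_of_lipschitzWith_one [PseudoMetricSpace X] {γ : ℝ → X}
    (hγ : LipschitzWith 1 γ) {l κ : ℝ} (hl : l ≤ dist (γ 0) (γ l) + κ) {s t : ℝ}
    (hs : s ∈ Icc 0 l) (ht : t ∈ Icc 0 l) : |s - t| - κ ≤ dist (γ s) (γ t) := by
  wlog hst : s ≤ t generalizing s t
  · rw [abs_sub_comm, dist_comm]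
    exact this ht hs (le_of_not_ge hst)
  rw [abs_sub_comm, abs_of_nonneg (sub_nonneg.2 hst)]
  linarith [dist_triangle4 (γ 0) (γ s) (γ t) (γ l),
    lipschitzWith_one_iff_dist_le_sub.1 hγ hs.1, lipschitzWith_one_iff_dist_le_sub.1 hγ ht.2]

/-- The curve that follows `γ₁` up to time `l` and `γ₂`, started at time `l`, afterwards. -/
noncomputable def concatCurve (l : ℝ) (γ₁ γ₂ : ℝ → X) (t : ℝ) : X :=
  if t ≤ l then γ₁ t else γ₂ (t - l)

lemma concatCurve_of_le {l t : ℝ} {γ₁ γ₂ : ℝ → X} (h : t ≤ l) : concatCurve l γ₁ γ₂ t = γ₁ t :=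
  if_pos h

lemma concatCurve_of_ge {l t : ℝ} {γ₁ γ₂ : ℝ → X} (hl : γ₁ l = γ₂ 0) (h : l ≤ t) :
    concatCurve l γ₁ γ₂ t = γ₂ (t - l) := by
  rcases h.eq_or_lt with rfl | h
  · rw [concatCurve_of_le le_rfl, sub_self, hl]
  · exact if_neg (not_le.2 h)

lemma lipschitzWith_one_concatCurve [PseudoMetricSpace X] {l : ℝ} {γ₁ γ₂ : ℝ → X}
    (h₁ : LipschitzWith 1 γ₁) (h₂ : LipschitzWith 1 γ₂) (hl : γ₁ l = γ₂ 0) :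
    LipschitzWith 1 (concatCurve l γ₁ γ₂) := by
  rw [lipschitzWith_one_iff_dist_le_sub] at *
  intro s t hst
  rcases le_total t l with htl | htl
  · rw [concatCurve_of_le htl, concatCurve_of_le (hst.trans htl)]
    exact h₁ hst
  rcases le_total s l with hsl | hsl
  · rw [concatCurve_of_le hsl, concatCurve_of_ge hl htl]
    have h := h₁ hsl
    rw [hl] at h
    linarith [dist_triangle (γ₁ s) (γ₂ 0) (γ₂ (t - l)), h₂ (sub_nonneg.2 htl)]
  · rw [concatCurve_of_ge hl hsl, concatCurve_of_ge hl htl]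
    linarith [h₂ (sub_le_sub_right hst l)]

/-- A length space: the distance of two points is the infimum of the lengths of the curves joining
them. Curves are encoded as `1`-Lipschitz maps on `ℝ`; since they may rest, every number above the
distance is the length of the time interval of such a curve. -/
def IsLengthSpace (X : Type*) [PseudoMetricSpace X] : Prop :=
  ∀ (x y : X) (l : ℝ), dist x y < l → ∃ γ : ℝ → X, LipschitzWith 1 γ ∧ γ 0 = x ∧ γ l = y

lemma IsLengthSpace.exists_dist_le_dist_lt [PseudoMetricSpace X] (hX : IsLengthSpace X) {x y : X}
    {a b : ℝ} (ha : 0 ≤ a) (hb : 0 < b) (h : dist x y < a + b) :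
    ∃ z, dist x z ≤ a ∧ dist z y < b := by
  obtain ⟨l, hl, hlab⟩ := exists_between (max_lt h (lt_add_of_pos_right a hb))
  obtain ⟨hdl, hal⟩ := max_lt_iff.1 hl
  obtain ⟨γ, hγ, rfl, rfl⟩ := hX x y l hdl
  exact ⟨γ a, (lipschitzWith_one_iff_dist_le_sub.1 hγ ha).trans_eq (sub_zero a),
    (lipschitzWith_one_iff_dist_le_sub.1 hγ hal.le).trans_lt (by linarith)⟩

lemma IsLengthSpace.isCompact_closedBall_of_forall_lt [PseudoMetricSpace X] [CompleteSpace X]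
    (hX : IsLengthSpace X) {x : X} {R : ℝ} (hR : 0 < R)
    (h : ∀ r < R, IsCompact (Metric.closedBall x r)) : IsCompact (Metric.closedBall x R) := by
  refine isCompact_iff_totallyBounded_isComplete.2
    ⟨Metric.totallyBounded_iff.2 fun ε hε => ?_, Metric.isClosed_closedBall.isComplete⟩
  obtain ⟨r, hr, hrR⟩ := exists_between (max_lt hR (sub_lt_self R (half_pos hε)))
  obtain ⟨hr0, hrε⟩ := max_lt_iff.1 hr
  obtain ⟨t, ht, hcover⟩ := Metric.totallyBounded_iff.1 (h r hrR).totallyBounded (ε / 2)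
    (half_pos hε)
  refine ⟨t, ht, fun y hy => ?_⟩
  obtain ⟨z, hxz, hzy⟩ := hX.exists_dist_le_dist_lt (x := x) (y := y) hr0.le (half_pos hε)
    (by linarith [Metric.mem_closedBall'.1 hy])
  obtain ⟨w, hwt, hzw⟩ := mem_iUnion₂.1 (hcover (Metric.mem_closedBall'.2 hxz))
  refine mem_iUnion₂.2 ⟨w, hwt, Metric.mem_ball.2 ?_⟩
  linarith [dist_triangle_left y w z, Metric.mem_ball.1 hzw]

lemma IsLengthSpace.exists_isCompact_closedBall_add [PseudoMetricSpace X] [LocallyCompactSpace X]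
    (hX : IsLengthSpace X) {x : X} {R : ℝ} (hR : 0 ≤ R) (h : IsCompact (Metric.closedBall x R)) :
    ∃ δ > 0, IsCompact (Metric.closedBall x (R + δ)) := by
  obtain ⟨δ, hδ, hcompact⟩ := h.exists_isCompact_cthickening
  refine ⟨δ / 2, half_pos hδ, hcompact.of_isClosed_subset Metric.isClosed_closedBall fun y hy => ?_⟩
  obtain ⟨z, hxz, hzy⟩ := hX.exists_dist_le_dist_lt (x := x) (y := y) hR hδ
    (by linarith [Metric.mem_closedBall'.1 hy])
  exact Metric.mem_cthickening_of_dist_le y z δ _ (Metric.mem_closedBall'.2 hxz)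
    (dist_comm z y ▸ hzy.le)

/-- The Hopf–Rinow theorem. -/
theorem IsLengthSpace.properSpace [PseudoMetricSpace X] [CompleteSpace X] [LocallyCompactSpace X]
    (hX : IsLengthSpace X) : ProperSpace X := by
  refine ⟨fun x R => ?_⟩
  by_contra hR
  set S := {r | IsCompact (Metric.closedBall x r)}
  have hanti : ∀ r ∈ S, ∀ s ≤ r, s ∈ S := fun r hr s hsr =>
    hr.of_isClosed_subset Metric.isClosed_closedBall (Metric.closedBall_subset_closedBall hsr)
  have h0 : IsCompact (Metric.closedBall x 0) :=
    Metric.closedBall_zero' x ▸ isCompact_singleton.closure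
  have hbdd : BddAbove S := ⟨R, fun r hr => le_of_not_ge fun h => hR (hanti r hr R h)⟩
  have hsup : sSup S ∈ S := by
    rcases (le_csSup hbdd h0).eq_or_lt with h | h
    · exact h ▸ h0
    · refine hX.isCompact_closedBall_of_forall_lt h fun r hr => ?_
      obtain ⟨s, hs, hrs⟩ := exists_lt_of_lt_csSup ⟨0, h0⟩ hr
      exact hanti s hs r hrs.le
  obtain ⟨δ, hδ, hmem⟩ := hX.exists_isCompact_closedBall_add (le_csSup hbdd h0) hsup
  linarith [le_csSup hbdd hmem]

lemma isCompact_setOf_lipschitzWith_one [MetricSpace X] [ProperSpace X] (x : X) :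
    IsCompact {γ : ℝ → X | LipschitzWith 1 γ ∧ γ 0 = x} := by
  refine (isCompact_univ_pi fun t : ℝ => isCompact_closedBall x |t|).of_isClosed_subset
    ((isClosed_setOfPred_lipschitzWith 1).inter (isClosed_eq (continuous_apply 0) continuous_const))
    ?_
  rintro γ ⟨hγ, rfl⟩ t -
  simpa using hγ.dist_le_mul t 0

theorem IsLengthSpace.exists_lipschitzWith_one [MetricSpace X] [ProperSpace X]
    (hX : IsLengthSpace X) (x y : X) :
    ∃ γ : ℝ → X, LipschitzWith 1 γ ∧ γ 0 = x ∧ γ (dist x y) = y := by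
  obtain ⟨γ, ⟨hγ, hγ0⟩, hmin⟩ := (isCompact_setOf_lipschitzWith_one x).exists_isMinOn
    (f := fun γ : ℝ → X => dist (γ (dist x y)) y)
    ⟨fun _ => x, LipschitzWith.const' x, rfl⟩ (by fun_prop)
  refine ⟨γ, hγ, hγ0, dist_le_zero.1 (le_of_forall_pos_le_add fun ε hε => ?_)⟩
  obtain ⟨γ', hγ', hγ'0, hγ'l⟩ := hX x y (dist x y + ε) (lt_add_of_pos_right _ hε)
  have hle : dist (γ' (dist x y)) y ≤ ε := by
    simpa [hγ'l] using
      lipschitzWith_one_iff_dist_le_sub.1 hγ' (le_add_of_nonneg_right (a := dist x y) hε.le)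
  exact (hmin ⟨hγ', hγ'0⟩).trans (by simpa using hle)

end LengthSpace

section GromovProduct

variable {X Y T : Type*} [PseudoMetricSpace X]

/-- The Gromov product `(x | y)_o`. -/
noncomputable def gromovProduct (o x y : X) : ℝ := (dist o x + dist o y - dist x y) / 2

lemma gromovProduct_le_dist_right (o x y : X) : gromovProduct o x y ≤ dist o y := by
  rw [gromovProduct]
  linarith [dist_triangle_right o x y]

lemma gromovProduct_le_of_add_le {o x y z : X} {δ : ℝ}
    (h : dist x z + dist z y ≤ dist x y + δ) : gromovProduct o x y ≤ dist o z + δ / 2 := by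
  rw [gromovProduct]
  linarith [dist_triangle_right o x z, dist_triangle o z y]

/-- Boundedness of the Gromov product near pairs of distinct boundary points: `X` is regarded as a
subset of `Y` by means of `i`, and a boundary point is a point of `closure (range i) \ range i`. -/
def HasBoundedGromovProduct [TopologicalSpace Y] (i : X → Y) : Prop :=
  ∀ p ∈ closure (range i) \ range i, ∀ q ∈ closure (range i) \ range i, p ≠ q → ∀ o : X,
    ∃ C, ∀ᶠ v in comap i (𝓝 p) ×ˢ comap i (𝓝 q), gromovProduct o v.1 v.2 ≤ C

lemma HasBoundedGromovProduct.exists_mem_nhds_min_le [TopologicalSpace Y] {i : X → Y}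
    (h : HasBoundedGromovProduct i) (hi : IsInducing i) {p q r : Y}
    (hp : p ∈ closure (range i) \ range i) (hq : q ∈ closure (range i) \ range i) (hpq : p ≠ q)
    (hr : r ∈ closure (range i)) (o : X) :
    ∃ U ∈ 𝓝 r, ∃ C, ∀ᶠ v in comap i (𝓝 p) ×ˢ comap i (𝓝 q), ∀ z, i z ∈ U →
      min (gromovProduct o v.1 z) (gromovProduct o z v.2) ≤ C := by
  by_cases hri : r ∈ range i
  · obtain ⟨x, rfl⟩ := hri
    have hx : ∀ᶠ z in comap i (𝓝 (i x)), dist o z < dist o x + 1 :=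
      hi.nhds_eq_comap x ▸ (continuous_const.dist continuous_id).continuousAt.eventually_lt_const
        (lt_add_one _)
    obtain ⟨U, hU, hUdist⟩ := eventually_comap.1 hx |>.exists_mem
    exact ⟨U, hU, _, .of_forall fun v z hz => (min_le_left _ _).trans
      ((gromovProduct_le_dist_right _ _ _).trans (hUdist _ hz z rfl).le)⟩
  by_cases hpr : p = r
  · obtain ⟨C, hC⟩ := h r ⟨hr, hri⟩ q hq (hpr ▸ hpq) o
    obtain ⟨P, hP, Q, hQ, hPQ⟩ := eventually_prod_iff.1 hC
    obtain ⟨U, hU, hUP⟩ := (eventually_comap.1 hP).exists_mem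
    refine ⟨U, hU, C, ?_⟩
    filter_upwards [tendsto_snd.eventually hQ] with v hv z hz
    exact (min_le_right _ _).trans (hPQ (hUP _ hz z rfl) hv)
  · obtain ⟨C, hC⟩ := h p hp r ⟨hr, hri⟩ hpr o
    obtain ⟨P, hP, Q, hQ, hPQ⟩ := eventually_prod_iff.1 hC
    obtain ⟨U, hU, hUQ⟩ := (eventually_comap.1 hQ).exists_mem
    refine ⟨U, hU, C, ?_⟩
    filter_upwards [tendsto_fst.eventually hP] with v hv z hz
    exact (min_le_left _ _).trans (hPQ hv (hUQ _ hz z rfl))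

-- In a Gromov hyperbolic space the minimum is at most `(v.1 | v.2)_o` up to a constant; here
-- compactness takes the place of hyperbolicity.
theorem HasBoundedGromovProduct.eventually_forall_min_le [TopologicalSpace Y] {i : X → Y}
    (h : HasBoundedGromovProduct i) (hi : IsInducing i) (hc : IsCompact (closure (range i)))
    {p q : Y} (hp : p ∈ closure (range i) \ range i) (hq : q ∈ closure (range i) \ range i)
    (hpq : p ≠ q) (o : X) :
    ∃ C, ∀ᶠ v in comap i (𝓝 p) ×ˢ comap i (𝓝 q), ∀ z,
      min (gromovProduct o v.1 z) (gromovProduct o z v.2) ≤ C := by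
  suffices hS : ∃ C, ∀ᶠ v in comap i (𝓝 p) ×ˢ comap i (𝓝 q), ∀ z, i z ∈ closure (range i) →
      min (gromovProduct o v.1 z) (gromovProduct o z v.2) ≤ C by
    obtain ⟨C, hC⟩ := hS
    exact ⟨C, hC.mono fun v hv z => hv z (subset_closure (mem_range_self z))⟩
  refine hc.induction_on (p := fun S => ∃ C, ∀ᶠ v in comap i (𝓝 p) ×ˢ comap i (𝓝 q), ∀ z,
    i z ∈ S → min (gromovProduct o v.1 z) (gromovProduct o z v.2) ≤ C) ?_ ?_ ?_ ?_
  · exact ⟨0, by simp⟩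
  · rintro S S' hSS' ⟨C, hC⟩
    exact ⟨C, hC.mono fun v hv z hz => hv z (hSS' hz)⟩
  · rintro S S' ⟨C, hC⟩ ⟨C', hC'⟩
    refine ⟨max C C', ?_⟩
    filter_upwards [hC, hC'] with v hv hv' z hz
    exact hz.elim (fun hz => le_max_of_le_left (hv z hz)) fun hz => le_max_of_le_right (hv' z hz)
  · intro r hr
    obtain ⟨U, hU, hbound⟩ := h.exists_mem_nhds_min_le hi hp hq hpq hr o
    exact ⟨U, mem_nhdsWithin_of_mem_nhds hU, hbound⟩

theorem exists_dist_le_of_min_gromovProduct_le [TopologicalSpace T] [PreconnectedSpace T]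
    {σ : T → X} (hσ : Continuous σ) {o : X} {a b : T} {δ C : ℝ}
    (hδ : ∀ t, dist (σ a) (σ t) + dist (σ t) (σ b) ≤ dist (σ a) (σ b) + δ)
    (hC : ∀ t, min (gromovProduct o (σ a) (σ t)) (gromovProduct o (σ t) (σ b)) ≤ C) :
    ∃ t, dist o (σ t) ≤ 2 * C + δ := by
  have hδ0 : 0 ≤ δ := by simpa using hδ a
  simp only [gromovProduct, min_le_iff] at hC
  rcases le_or_gt (dist o (σ a)) (dist (σ a) (σ b)) with hab | hab
  · -- if `σ t` is as far from `σ a` as `o` is, both Gromov products are about `dist o (σ t) / 2`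
    obtain ⟨t, ht⟩ : ∃ t, dist (σ a) (σ t) = dist o (σ a) :=
      intermediate_value_univ a b (continuous_const.dist hσ) ⟨by simp, hab⟩
    refine ⟨t, ?_⟩
    rcases hC t with h | h <;>
      linarith [hδ t, dist_triangle_left (σ a) (σ b) o]
  · refine ⟨b, ?_⟩
    rcases hC b with h | h <;>
      linarith [dist_self (σ b), dist_nonneg (x := o) (y := σ b)]

end GromovProduct

section Tanh

lemma tanh_pos {t : ℝ} (ht : 0 < t) : 0 < Real.tanh t := by
  rw [Real.tanh_eq_sinh_div_cosh]
  exact div_pos (Real.sinh_pos_iff.2 ht) (Real.cosh_pos t)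

lemma abs_tanh (t : ℝ) : |Real.tanh t| = Real.tanh |t| := by
  rw [Real.tanh_eq_sinh_div_cosh, abs_div, Real.abs_sinh, abs_of_pos (Real.cosh_pos t),
    Real.tanh_eq_sinh_div_cosh, Real.cosh_abs]

lemma tanh_sub (s t : ℝ) :
    Real.tanh (s - t) = (Real.tanh s - Real.tanh t) / (1 - Real.tanh s * Real.tanh t) := by
  have hs := (Real.cosh_pos s).ne'
  have ht := (Real.cosh_pos t).ne'
  have hden : 1 - Real.sinh s / Real.cosh s * (Real.sinh t / Real.cosh t) =
      Real.cosh (s - t) / (Real.cosh s * Real.cosh t) := by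
    rw [Real.cosh_sub]
    field_simp
  have hst := (Real.cosh_pos (s - t)).ne'
  simp only [Real.tanh_eq_sinh_div_cosh, hden, Real.sinh_sub]
  field_simp

lemma hasDerivAt_tanh (t : ℝ) : HasDerivAt Real.tanh (1 - Real.tanh t ^ 2) t := by
  have h := (Real.hasDerivAt_sinh t).div (Real.hasDerivAt_cosh t) (Real.cosh_pos t).ne'
  refine (h.congr_of_eventuallyEq (.of_forall Real.tanh_eq_sinh_div_cosh)).congr_deriv ?_
  have hcosh := (Real.cosh_pos t).ne'
  rw [Real.tanh_eq_sinh_div_cosh]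
  field_simp

lemma abs_tanh_le_abs (t : ℝ) : |Real.tanh t| ≤ |t| := by
  have hbound : ∀ x ∈ univ, ‖deriv Real.tanh x‖ ≤ 1 := fun x _ => by
    rw [(hasDerivAt_tanh x).deriv, Real.norm_eq_abs, abs_le]
    constructor <;> linarith [Real.tanh_sq_lt_one x, sq_nonneg (Real.tanh x)]
  simpa using convex_univ.norm_image_sub_le_of_norm_deriv_le
    (fun x _ => (hasDerivAt_tanh x).differentiableAt) hbound (mem_univ 0) (mem_univ t)

end Tanh

section UnitDisc

open scoped ComplexConjugate

lemma mem_unitDisc {z : ℂ} : z ∈ unitDisc ↔ ‖z‖ < 1 := by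
  simp [unitDisc]

lemma isOpen_unitDisc : IsOpen unitDisc := Metric.isOpen_ball

lemma zero_mem_unitDisc : (0 : ℂ) ∈ unitDisc := by
  simp [unitDisc]

lemma neg_mem_unitDisc {a : ℂ} (ha : a ∈ unitDisc) : -a ∈ unitDisc := by
  rwa [mem_unitDisc, norm_neg, ← mem_unitDisc]

lemma ofReal_tanh_mem_unitDisc (t : ℝ) : (Real.tanh t : ℂ) ∈ unitDisc := by
  rw [mem_unitDisc, Complex.norm_real]
  exact Real.abs_tanh_lt_one t

/-- The automorphism of the unit disc with derivative `1 - ‖a‖ ^ 2` at `0` that takes `0` to `a`. -/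
noncomputable def discAut (a z : ℂ) : ℂ := (z + a) / (1 + conj a * z)

@[simp] lemma discAut_zero (a : ℂ) : discAut a 0 = a := by
  simp [discAut]

lemma one_add_conj_mul_ne_zero {a z : ℂ} (ha : a ∈ unitDisc) (hz : z ∈ unitDisc) :
    1 + conj a * z ≠ 0 := by
  rw [mem_unitDisc] at ha hz
  intro h
  have hnorm : ‖a‖ * ‖z‖ = 1 := by
    simpa using congrArg norm (eq_neg_of_add_eq_zero_right h)
  nlinarith [norm_nonneg a, norm_nonneg z]

lemma norm_one_add_conj_mul_sq_sub (a z : ℂ) :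
    ‖1 + conj a * z‖ ^ 2 - ‖z + a‖ ^ 2 = (1 - ‖a‖ ^ 2) * (1 - ‖z‖ ^ 2) := by
  simp only [← Complex.normSq_eq_norm_sq, Complex.normSq_apply, Complex.add_re, Complex.add_im,
    Complex.mul_re, Complex.mul_im, Complex.conj_re, Complex.conj_im, Complex.one_re,
    Complex.one_im]
  ring

lemma mapsTo_discAut {a : ℂ} (ha : a ∈ unitDisc) : MapsTo (discAut a) unitDisc unitDisc := by
  intro z hz
  have hden := norm_pos_iff.2 (one_add_conj_mul_ne_zero ha hz)
  rw [mem_unitDisc] at ha hz ⊢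
  rw [discAut, norm_div, div_lt_one hden]
  have hpos : 0 < (1 - ‖a‖ ^ 2) * (1 - ‖z‖ ^ 2) := by
    apply mul_pos <;> rw [sub_pos, sq_lt_one_iff₀ (norm_nonneg _)] <;> assumption
  exact lt_of_pow_lt_pow_left₀ 2 hden.le (by linarith [norm_one_add_conj_mul_sq_sub a z])

lemma discAut_discAut_neg {a z : ℂ} (ha : a ∈ unitDisc) (hz : z ∈ unitDisc) :
    discAut a (discAut (-a) z) = z := by
  have hden := one_add_conj_mul_ne_zero (neg_mem_unitDisc ha) hz
  have hden' := one_add_conj_mul_ne_zero ha (mapsTo_discAut (neg_mem_unitDisc ha) hz)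
  rw [discAut, div_eq_iff hden', discAut]
  have hcancel := div_mul_cancel₀ (z + -a) hden
  rw [map_neg] at hcancel ⊢
  linear_combination hcancel

lemma hasDerivAt_discAut {a z : ℂ} (ha : a ∈ unitDisc) (hz : z ∈ unitDisc) :
    HasDerivAt (discAut a) ((1 - conj a * a) / (1 + conj a * z) ^ 2) z :=
  (((hasDerivAt_id z).add_const a).div (((hasDerivAt_id z).const_mul (conj a)).const_add 1)
    (one_add_conj_mul_ne_zero ha hz)).congr_deriv (by simp only [id]; ring)

lemma differentiableOn_discAut {a : ℂ} (ha : a ∈ unitDisc) :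
    DifferentiableOn ℂ (discAut a) unitDisc :=
  fun _ hz => (hasDerivAt_discAut ha hz).differentiableAt.differentiableWithinAt

lemma poincareDist_comm (a b : ℂ) : poincareDist a b = poincareDist b a := by
  rw [poincareDist, poincareDist, norm_sub_rev a b, ← Complex.norm_conj (1 - _)]
  simp [mul_comm]

lemma poincareDist_nonneg (a b : ℂ) : 0 ≤ poincareDist a b :=
  Real.artanh_nonneg (by positivity)

lemma poincareDist_eq_artanh_norm_discAut (a b : ℂ) :
    poincareDist a b = Real.artanh ‖discAut (-a) b‖ := by
  rw [poincareDist_comm, poincareDist, discAut, norm_div, map_neg, neg_mul, ← sub_eq_add_neg,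
    ← sub_eq_add_neg]

lemma tanh_poincareDist {a b : ℂ} (ha : a ∈ unitDisc) (hb : b ∈ unitDisc) :
    Real.tanh (poincareDist a b) = ‖discAut (-a) b‖ := by
  rw [poincareDist_eq_artanh_norm_discAut]
  exact Real.tanh_artanh ⟨(neg_one_lt_zero).trans_le (norm_nonneg _),
    mem_unitDisc.1 (mapsTo_discAut (neg_mem_unitDisc ha) hb)⟩

lemma poincareDist_tanh (s t : ℝ) : poincareDist (Real.tanh s) (Real.tanh t) = |s - t| := by
  have hquot : ((Real.tanh s : ℂ) - Real.tanh t) / (1 - Real.tanh t * Real.tanh s) =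
      (Real.tanh (s - t) : ℝ) := by
    rw [tanh_sub, mul_comm (Real.tanh s)]
    push_cast
    rfl
  rw [poincareDist, ← norm_div, Complex.conj_ofReal, hquot, Complex.norm_real, Real.norm_eq_abs,
    abs_tanh, Real.artanh_tanh]

end UnitDisc

section HolomorphicDisc

variable {d : ℕ} {M : Set (CSpace d)} {φ : ℂ → CSpace d}

lemma IsHolomorphicDisc.comp (hφ : IsHolomorphicDisc M φ) {f : ℂ → ℂ}
    (hf : DifferentiableOn ℂ f unitDisc) (hmaps : MapsTo f unitDisc unitDisc) :
    IsHolomorphicDisc M (φ ∘ f) :=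
  ⟨hφ.1.comp hf hmaps, hφ.2.comp hmaps⟩

lemma isHolomorphicDisc_const {z : CSpace d} (hz : z ∈ M) : IsHolomorphicDisc M fun _ => z :=
  ⟨differentiableOn_const z, fun _ _ => hz⟩

lemma IsHolomorphicDisc.exists_tanh_poincareDist (hφ : IsHolomorphicDisc M φ) {a b : ℂ}
    (ha : a ∈ unitDisc) (hb : b ∈ unitDisc) :
    ∃ ψ, IsHolomorphicDisc M ψ ∧ ψ 0 = φ a ∧ ψ (Real.tanh (poincareDist a b)) = φ b := by
  obtain ⟨u, hu, hub⟩ : ∃ u : ℂ, ‖u‖ = 1 ∧ u * ‖discAut (-a) b‖ = discAut (-a) b := by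
    generalize discAut (-a) b = w
    rcases eq_or_ne w 0 with rfl | hw
    · exact ⟨1, by simp, by simp⟩
    · exact ⟨w / ‖w‖, by simp [hw], by simp [hw]⟩
  have hrot : MapsTo (u * ·) unitDisc unitDisc := fun z hz => by
    rw [mem_unitDisc] at hz ⊢
    simpa [hu] using hz
  refine ⟨_, (hφ.comp (differentiableOn_discAut ha) (mapsTo_discAut ha)).comp
    (differentiableOn_id.const_mul u) hrot, by simp, ?_⟩
  rw [tanh_poincareDist ha hb, Function.comp_apply, Function.comp_apply, hub,
    discAut_discAut_neg ha hb]

lemma IsHolomorphicDisc.kobayashiRoyden_deriv_zero_le (hφ : IsHolomorphicDisc M φ) :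
    kobayashiRoyden M (φ 0) (deriv φ 0) ≤ 1 :=
  (iInf₂_le 1 ⟨φ, hφ, rfl, one_smul ℂ _⟩).trans (by simp)

lemma IsHolomorphicDisc.kobayashiRoyden_tanh_le (hφ : IsHolomorphicDisc M φ) (t : ℝ) :
    kobayashiRoyden M (φ (Real.tanh t)) (deriv (fun s : ℝ => φ (Real.tanh s)) t) ≤ 1 := by
  have ht := ofReal_tanh_mem_unitDisc t
  have hderiv : HasDerivAt φ (deriv φ (Real.tanh t)) (Real.tanh t) :=
    (hφ.1.differentiableAt (isOpen_unitDisc.mem_nhds ht)).hasDerivAt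
  have hcurve : HasDerivAt (fun s : ℝ => φ (Real.tanh s))
      ((1 - (Real.tanh t : ℂ) ^ 2) • deriv φ (Real.tanh t)) t :=
    (hderiv.scomp t (hasDerivAt_tanh t).ofReal_comp).congr_deriv (by push_cast; rfl)
  have hdisc : HasDerivAt (φ ∘ discAut (Real.tanh t))
      ((1 - (Real.tanh t : ℂ) ^ 2) • deriv φ (Real.tanh t)) 0 := by
    rw [← discAut_zero (Real.tanh t : ℂ)] at hderiv
    refine (hderiv.scomp 0 (hasDerivAt_discAut ht zero_mem_unitDisc)).congr_deriv ?_
    rw [discAut_zero, Complex.conj_ofReal, mul_zero, add_zero, one_pow, div_one, sq]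
  have hle := IsHolomorphicDisc.kobayashiRoyden_deriv_zero_le
    (hφ.comp (differentiableOn_discAut ht) (mapsTo_discAut ht))
  rwa [Function.comp_apply, discAut_zero, hdisc.deriv, ← hcurve.deriv] at hle

lemma IsHolomorphicDisc.dist_le (hφ : IsHolomorphicDisc M φ) {C : ℝ}
    (hC : ∀ z ∈ M, ∀ w ∈ M, dist z w ≤ C) {a b : ℂ} (ha : a ∈ unitDisc) (hb : b ∈ unitDisc) :
    dist (φ a) (φ b) ≤ C * poincareDist a b := by
  obtain ⟨ψ, hψ, hψa, hψb⟩ := hφ.exists_tanh_poincareDist ha hb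
  have hmaps : MapsTo ψ (Metric.ball 0 1) (Metric.closedBall (ψ 0) C) :=
    fun z hz => hC _ (hψ.2 hz) _ (hψ.2 zero_mem_unitDisc)
  have hC0 : 0 ≤ C := dist_nonneg.trans (hC _ (hφ.2 ha) _ (hφ.2 ha))
  rw [dist_comm, ← hψa, ← hψb]
  calc dist (ψ (Real.tanh (poincareDist a b))) (ψ 0)
      ≤ C / 1 * dist (Real.tanh (poincareDist a b) : ℂ) 0 :=
        Complex.dist_le_div_mul_dist_of_mapsTo_ball hψ.1 hmaps (ofReal_tanh_mem_unitDisc _)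
    _ = C * |Real.tanh (poincareDist a b)| := by
        rw [div_one, dist_zero_right, Complex.norm_real, Real.norm_eq_abs]
    _ ≤ C * |poincareDist a b| := mul_le_mul_of_nonneg_left (abs_tanh_le_abs _) hC0
    _ = C * poincareDist a b := by rw [abs_of_nonneg (poincareDist_nonneg a b)]

end HolomorphicDisc

section ChainLength

variable {d : ℕ} {M : Set (CSpace d)} {x y z : CSpace d} {c c' : ℝ}

lemma IsChainLength.refl (z : CSpace d) : IsChainLength M z z 0 :=
  ⟨0, fun _ => z, fun _ _ => 0, fun _ => 0, fun _ => 0, rfl, rfl, by simp, by simp⟩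

lemma IsChainLength.snoc (h : IsChainLength M x y c) {φ : ℂ → CSpace d} {a b : ℂ}
    (hφ : IsHolomorphicDisc M φ) (ha : a ∈ unitDisc) (hb : b ∈ unitDisc) (hay : φ a = y) :
    IsChainLength M x (φ b) (c + poincareDist a b) := by
  obtain ⟨m, p, ψ, a', b', rfl, rfl, hchain, rfl⟩ := h
  refine ⟨m + 1, fun i => if i ≤ m then p i else φ b, fun i => if i < m then ψ i else φ,
    fun i => if i < m then a' i else a, fun i => if i < m then b' i else b, by simp, by simp,
    fun i hi => ?_, ?_⟩
  · rcases Nat.lt_succ_iff_lt_or_eq.1 hi with hi | rfl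
    · simpa [hi, hi.le, Nat.succ_le_of_lt hi] using hchain i hi
    · simp [hφ, ha, hb, hay]
  · rw [Finset.sum_range_succ]
    congr 1
    · exact Finset.sum_congr rfl fun i hi => by simp [Finset.mem_range.1 hi]
    · simp

theorem IsChainLength.induction {P : CSpace d → ℝ → Prop} (refl : P x 0)
    (snoc : ∀ (y : CSpace d) (c : ℝ) (φ : ℂ → CSpace d) (a b : ℂ), IsChainLength M x y c → P y c →
      IsHolomorphicDisc M φ → a ∈ unitDisc → b ∈ unitDisc → φ a = y →
      P (φ b) (c + poincareDist a b)) (h : IsChainLength M x y c) : P y c := by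
  obtain ⟨m, p, φ, a, b, rfl, rfl, hchain, rfl⟩ := h
  induction m with
  | zero => simpa using refl
  | succ m ih =>
    obtain ⟨hφ, ha, hb, hpa, hpb⟩ := hchain m m.lt_succ_self
    have hchain' := fun i (hi : i < m) => hchain i (hi.trans m.lt_succ_self)
    rw [Finset.sum_range_succ, ← hpb]
    exact snoc (p m) _ (φ m) (a m) (b m) ⟨m, p, φ, a, b, rfl, rfl, hchain', rfl⟩ (ih hchain')
      hφ ha hb hpa

lemma IsChainLength.nonneg (h : IsChainLength M x y c) : 0 ≤ c :=
  IsChainLength.induction (P := fun _ c => 0 ≤ c) le_rfl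
    (fun _ _ _ a b _ hc _ _ _ _ => add_nonneg hc (poincareDist_nonneg a b)) h

lemma IsChainLength.trans (h : IsChainLength M x y c) (h' : IsChainLength M y z c') :
    IsChainLength M x z (c + c') := by
  refine IsChainLength.induction (P := fun z c' => IsChainLength M x z (c + c')) (by simpa using h)
    (fun w c' φ a b _ ih hφ ha hb haw => ?_) h'
  rw [← add_assoc]
  exact ih.snoc hφ ha hb haw

lemma IsHolomorphicDisc.isChainLength {φ : ℂ → CSpace d} {a b : ℂ} (hφ : IsHolomorphicDisc M φ)
    (ha : a ∈ unitDisc) (hb : b ∈ unitDisc) : IsChainLength M (φ a) (φ b) (poincareDist a b) := by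
  simpa using (IsChainLength.refl (φ a)).snoc hφ ha hb rfl

lemma IsChainLength.symm (h : IsChainLength M x y c) : IsChainLength M y x c := by
  refine IsChainLength.induction (P := fun y c => IsChainLength M y x c) (IsChainLength.refl x)
    (fun y c φ a b _ ih hφ ha hb hay => ?_) h
  rw [add_comm, poincareDist_comm]
  exact (hφ.isChainLength hb ha).trans (hay ▸ ih)

lemma IsChainLength.dist_le {C : ℝ} (hC : ∀ z ∈ M, ∀ w ∈ M, dist z w ≤ C)
    (h : IsChainLength M x y c) : dist x y ≤ C * c := by
  refine IsChainLength.induction (P := fun y c => dist x y ≤ C * c) (by simp) ?_ h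
  rintro y c φ a b - ih hφ ha hb rfl
  calc dist x (φ b) ≤ dist x (φ a) + dist (φ a) (φ b) := dist_triangle _ _ _
    _ ≤ C * c + C * poincareDist a b := add_le_add ih (hφ.dist_le hC ha hb)
    _ = C * (c + poincareDist a b) := (mul_add _ _ _).symm

lemma IsChainLength.kobayashiDist_le (h : IsChainLength M x y c) : kobayashiDist M x y ≤ c :=
  csInf_le ⟨0, fun _ hc => IsChainLength.nonneg hc⟩ h

lemma kobayashiDist_nonneg (x y : CSpace d) : 0 ≤ kobayashiDist M x y :=
  Real.sInf_nonneg fun _ hc => IsChainLength.nonneg hc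

lemma kobayashiDist_self (x : CSpace d) : kobayashiDist M x x = 0 :=
  le_antisymm (IsChainLength.refl x).kobayashiDist_le (kobayashiDist_nonneg x x)

lemma kobayashiDist_comm (x y : CSpace d) : kobayashiDist M x y = kobayashiDist M y x :=
  congrArg sInf (Set.ext fun _ => ⟨IsChainLength.symm, IsChainLength.symm⟩)

end ChainLength

section Submanifold

variable {d : ℕ} {M : Set (CSpace d)} {p : CSpace d}

lemma IsEmbeddedComplexSubmanifold.isLocallyClosed (hM : IsEmbeddedComplexSubmanifold M) :
    IsLocallyClosed M := by
  obtain ⟨n, hM⟩ := hM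
  refine ((isLocallyClosed_tfae M).out 0 2).2 fun p hp => ?_
  obtain ⟨Φ, L, hpΦ, -, -, -, hL⟩ := hM p hp
  refine ⟨Φ.source, Φ.open_source.mem_nhds hpΦ, ?_⟩
  have hpreimage : (Subtype.val ⁻¹' M : Set Φ.source) = Φ.source.domRestrict Φ ⁻¹' L :=
    Set.ext fun x => hL x x.2
  rw [hpreimage]
  exact L.closed_of_finiteDimensional.preimage Φ.continuousOn.domRestrict

-- In a chart of `M` the disc lies on the complex line through the images of `p` and `z`.
lemma IsEmbeddedComplexSubmanifold.eventually_exists_isHolomorphicDisc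
    (hM : IsEmbeddedComplexSubmanifold M) (hp : p ∈ M) {δ : ℝ} (hδ : 0 < δ) :
    ∀ᶠ z in 𝓝[M] p, ∃ φ, IsHolomorphicDisc M φ ∧ φ 0 = p ∧ φ δ = z := by
  obtain ⟨n, hM⟩ := hM
  obtain ⟨Φ, L, hpΦ, -, hΦsymm, -, hL⟩ := hM p hp
  obtain ⟨r, hr, hball⟩ := Metric.isOpen_iff.1 Φ.open_target _ (Φ.map_source hpΦ)
  have hnear : ∀ᶠ z in 𝓝 p, Φ z ∈ Metric.ball (Φ p) (δ * r) :=
    (Φ.continuousAt hpΦ).eventually (Metric.ball_mem_nhds _ (by positivity))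
  filter_upwards [self_mem_nhdsWithin, mem_nhdsWithin_of_mem_nhds hnear,
    mem_nhdsWithin_of_mem_nhds (Φ.open_source.mem_nhds hpΦ)] with z hzM hz hzΦ
  let line : ℂ → CSpace d := fun ζ => Φ p + (ζ / δ) • (Φ z - Φ p)
  have hline : MapsTo line unitDisc Φ.target := by
    refine fun ζ hζ => hball ?_
    rw [mem_unitDisc] at hζ
    rw [Metric.mem_ball, dist_eq_norm] at hz ⊢
    calc ‖line ζ - Φ p‖ = ‖ζ‖ * (‖Φ z - Φ p‖ / δ) := by
          simp only [line, add_sub_cancel_left, norm_smul, norm_div, Complex.norm_real,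
            Real.norm_of_nonneg hδ.le]
          ring
      _ ≤ 1 * (‖Φ z - Φ p‖ / δ) := by gcongr
      _ < r := by rwa [one_mul, div_lt_iff₀' hδ]
  have hδ' : (δ : ℂ) ≠ 0 := Complex.ofReal_ne_zero.2 hδ.ne'
  refine ⟨Φ.symm ∘ line, ⟨hΦsymm.comp (by fun_prop) hline, fun ζ hζ => ?_⟩, ?_, ?_⟩
  · rw [Function.comp_apply, hL _ (Φ.map_target (hline hζ)), Φ.right_inv (hline hζ)]
    have hpL := (hL p hpΦ).1 hp
    exact L.add_mem hpL (L.smul_mem _ (L.sub_mem ((hL z hzΦ).1 hzM) hpL))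
  · simp [line, Φ.left_inv hpΦ]
  · simp [line, hδ', Φ.left_inv hzΦ]

lemma IsEmbeddedComplexSubmanifold.eventually_isChainLength (hM : IsEmbeddedComplexSubmanifold M)
    (hp : p ∈ M) {ε : ℝ} (hε : 0 < ε) : ∀ᶠ z in 𝓝[M] p, IsChainLength M p z ε := by
  filter_upwards [hM.eventually_exists_isHolomorphicDisc hp (tanh_pos hε)] with z hz
  obtain ⟨φ, hφ, rfl, rfl⟩ := hz
  have hchain := hφ.isChainLength (ofReal_tanh_mem_unitDisc 0) (ofReal_tanh_mem_unitDisc ε)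
  rwa [poincareDist_tanh, zero_sub, abs_neg, abs_of_pos hε, Real.tanh_zero, Complex.ofReal_zero]
    at hchain

lemma IsEmbeddedComplexSubmanifold.tendsto_kobayashiDist (hM : IsEmbeddedComplexSubmanifold M)
    (hp : p ∈ M) : Tendsto (kobayashiDist M p) (𝓝[M] p) (𝓝 0) := by
  refine tendsto_order.2 ⟨fun ε hε => .of_forall fun z => hε.trans_le (kobayashiDist_nonneg p z),
    fun ε hε => ?_⟩
  filter_upwards [hM.eventually_isChainLength hp (half_pos hε)] with z hz
  exact hz.kobayashiDist_le.trans_lt (half_lt_self hε)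

variable {x y z : CSpace d}

lemma IsEmbeddedComplexSubmanifold.exists_isChainLength (hM : IsEmbeddedComplexSubmanifold M)
    (hconn : IsPreconnected M) (hx : x ∈ M) (hy : y ∈ M) : ∃ c, IsChainLength M x y c := by
  refine hconn.induction₂' (fun x y => ∃ c, IsChainLength M x y c) (fun x hx => ?_) ?_ hx hy
  · filter_upwards [hM.eventually_isChainLength hx one_pos] with y hy
    exact ⟨⟨1, hy⟩, ⟨1, hy.symm⟩⟩
  · rintro x y z - - - ⟨c, hc⟩ ⟨c', hc'⟩
    exact ⟨_, hc.trans hc'⟩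

lemma IsEmbeddedComplexSubmanifold.exists_isChainLength_lt (hM : IsEmbeddedComplexSubmanifold M)
    (hconn : IsPreconnected M) (hx : x ∈ M) (hy : y ∈ M) {r : ℝ} (hr : kobayashiDist M x y < r) :
    ∃ c < r, IsChainLength M x y c := by
  obtain ⟨c, hc, hcr⟩ := exists_lt_of_csInf_lt (hM.exists_isChainLength hconn hx hy) hr
  exact ⟨c, hcr, hc⟩

lemma IsEmbeddedComplexSubmanifold.kobayashiDist_triangle (hM : IsEmbeddedComplexSubmanifold M)
    (hconn : IsPreconnected M) (hx : x ∈ M) (hy : y ∈ M) (hz : z ∈ M) :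
    kobayashiDist M x z ≤ kobayashiDist M x y + kobayashiDist M y z := by
  refine le_of_forall_pos_lt_add fun ε hε => ?_
  obtain ⟨c, hc, hxy⟩ := hM.exists_isChainLength_lt hconn hx hy
    (lt_add_of_pos_right _ (half_pos hε))
  obtain ⟨c', hc', hyz⟩ := hM.exists_isChainLength_lt hconn hy hz
    (lt_add_of_pos_right _ (half_pos hε))
  linarith [(hxy.trans hyz).kobayashiDist_le]

lemma IsEmbeddedComplexSubmanifold.exists_dist_le_mul_kobayashiDist
    (hM : IsEmbeddedComplexSubmanifold M) (hconn : IsPreconnected M)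
    (hbdd : Bornology.IsBounded M) :
    ∃ C > 0, ∀ x ∈ M, ∀ y ∈ M, dist x y ≤ C * kobayashiDist M x y := by
  obtain ⟨C, hC⟩ := Metric.isBounded_iff.1 hbdd
  have hpos : 0 < max C 1 := by positivity
  refine ⟨max C 1, hpos, fun x hx y hy => ?_⟩
  rw [← div_le_iff₀' hpos]
  refine le_csInf (hM.exists_isChainLength hconn hx hy) fun c hc => ?_
  rw [div_le_iff₀' hpos]
  exact IsChainLength.dist_le (fun z hz w hw => (hC hz hw).trans (le_max_left C 1)) hc

end Submanifold

section KobayashiSpace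

variable {d : ℕ} {M : Set (CSpace d)}

/-- A bounded, connected, embedded complex submanifold of `ℂ^d`; as a class, so that the Kobayashi
metric can be an instance. -/
class IsBoundedSubmanifold (M : Set (CSpace d)) : Prop where
  isEmbedded : IsEmbeddedComplexSubmanifold M
  isConnected : IsConnected M
  isBounded : Bornology.IsBounded M

/-- The metric space `(M, k_M)`, kept apart from the subtype of `M` because that carries the
Euclidean metric. -/
@[ext]
structure KobayashiSpace (M : Set (CSpace d)) where
  val : CSpace d
  mem : val ∈ M

namespace KobayashiSpace

lemma range_val : range (val : KobayashiSpace M → CSpace d) = M :=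
  Subset.antisymm (range_subset_iff.2 mem) fun z hz => ⟨⟨z, hz⟩, rfl⟩

noncomputable instance : TopologicalSpace (KobayashiSpace M) := .induced val inferInstance

lemma isInducing_val : IsInducing (val : KobayashiSpace M → CSpace d) := ⟨rfl⟩

variable [IsBoundedSubmanifold M]

lemma isOpen_iff_kobayashiDist {s : Set (KobayashiSpace M)} :
    IsOpen s ↔ ∀ x ∈ s, ∃ ε > 0, ∀ y, kobayashiDist M x.val y.val < ε → y ∈ s := by
  have hM : IsEmbeddedComplexSubmanifold M := IsBoundedSubmanifold.isEmbedded
  obtain ⟨C, hC, hle⟩ := hM.exists_dist_le_mul_kobayashiDist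
    IsBoundedSubmanifold.isConnected.isPreconnected IsBoundedSubmanifold.isBounded
  rw [isOpen_iff_mem_nhds]
  refine forall₂_congr fun x _ => ?_
  rw [isInducing_val.nhds_eq_comap]
  constructor
  · intro hs
    obtain ⟨ε, hε, hball⟩ := (Metric.nhds_basis_ball.comap _).mem_iff.1 hs
    refine ⟨ε / C, by positivity, fun y hy => hball (Metric.mem_ball'.2 ?_)⟩
    exact (hle _ x.mem _ y.mem).trans_lt ((lt_div_iff₀' hC).1 hy)
  · rintro ⟨ε, hε, hs⟩
    have hnear := eventually_nhdsWithin_iff.1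
      ((hM.tendsto_kobayashiDist x.mem).eventually (gt_mem_nhds hε))
    exact mem_of_superset (preimage_mem_comap hnear) fun y hy => hs y (hy y.mem)

noncomputable instance : MetricSpace (KobayashiSpace M) :=
  .ofDistTopology (fun x y => kobayashiDist M x.val y.val) (fun _ => kobayashiDist_self _)
    (fun _ _ => kobayashiDist_comm _ _)
    (fun x y z => IsBoundedSubmanifold.isEmbedded.kobayashiDist_triangle
      IsBoundedSubmanifold.isConnected.isPreconnected x.mem y.mem z.mem)
    (fun _ => isOpen_iff_kobayashiDist)
    (fun x y hxy => by
      obtain ⟨C, -, hle⟩ := IsBoundedSubmanifold.isEmbedded.exists_dist_le_mul_kobayashiDist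
        IsBoundedSubmanifold.isConnected.isPreconnected (IsBoundedSubmanifold.isBounded (M := M))
      refine KobayashiSpace.ext (dist_le_zero.1 ?_)
      simpa only [hxy, mul_zero] using hle _ x.mem _ y.mem)

lemma dist_eq (x y : KobayashiSpace M) : dist x y = kobayashiDist M x.val y.val := rfl

lemma exists_lipschitzWith_val : ∃ C, LipschitzWith C (val : KobayashiSpace M → CSpace d) := by
  obtain ⟨C, hC, hle⟩ := IsBoundedSubmanifold.isEmbedded.exists_dist_le_mul_kobayashiDist
    IsBoundedSubmanifold.isConnected.isPreconnected (IsBoundedSubmanifold.isBounded (M := M))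
  exact ⟨⟨C, hC.le⟩, LipschitzWith.of_dist_le_mul fun x y => hle _ x.mem _ y.mem⟩

instance : LocallyCompactSpace (KobayashiSpace M) :=
  isInducing_val.locallyCompactSpace
    (range_val.symm ▸ (IsBoundedSubmanifold.isEmbedded (M := M)).isLocallyClosed)

instance : Nonempty (KobayashiSpace M) :=
  let ⟨z, hz⟩ := (IsBoundedSubmanifold.isConnected (M := M)).nonempty
  ⟨⟨z, hz⟩⟩

lemma completeSpace (hM : IsKobayashiComplete M) : CompleteSpace (KobayashiSpace M) := by
  refine Metric.complete_of_cauchySeq_tendsto fun u hu => ?_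
  obtain ⟨z, hz, hlim⟩ := hM (fun n => (u n).val) (fun n => (u n).mem) (Metric.cauchySeq_iff.1 hu)
  exact ⟨⟨z, hz⟩, tendsto_iff_dist_tendsto_zero.2 hlim⟩

end KobayashiSpace

/-- A curve in `(M, k_M)` that is `1`-Lipschitz and has Kobayashi–Royden speed at most `1` almost
everywhere. -/
structure IsSubunit [IsBoundedSubmanifold M] (γ : ℝ → KobayashiSpace M) : Prop where
  lipschitzWith : LipschitzWith 1 γ
  speed : ∀ᵐ t, kobayashiRoyden M (γ t).val (deriv (fun s => (γ s).val) t) ≤ 1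

section Subunit

variable [IsBoundedSubmanifold M]

lemma isSubunit_const (x : KobayashiSpace M) : IsSubunit fun _ => x := by
  refine ⟨LipschitzWith.const' x, .of_forall fun t => ?_⟩
  simpa using (isHolomorphicDisc_const x.mem).kobayashiRoyden_deriv_zero_le

lemma IsHolomorphicDisc.isSubunit {φ : ℂ → CSpace d} (hφ : IsHolomorphicDisc M φ) :
    IsSubunit (M := M) fun t => ⟨φ (Real.tanh t), hφ.2 (ofReal_tanh_mem_unitDisc t)⟩ := by
  refine ⟨LipschitzWith.mk_one fun s t => ?_, .of_forall hφ.kobayashiRoyden_tanh_le⟩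
  rw [KobayashiSpace.dist_eq, Real.dist_eq, ← poincareDist_tanh]
  exact (hφ.isChainLength (ofReal_tanh_mem_unitDisc s)
    (ofReal_tanh_mem_unitDisc t)).kobayashiDist_le

lemma IsSubunit.concat {γ₁ γ₂ : ℝ → KobayashiSpace M} (h₁ : IsSubunit γ₁)
    (h₂ : IsSubunit γ₂) {l : ℝ} (hl : γ₁ l = γ₂ 0) : IsSubunit (concatCurve l γ₁ γ₂) := by
  refine ⟨lipschitzWith_one_concatCurve h₁.lipschitzWith h₂.lipschitzWith hl, ?_⟩
  filter_upwards [h₁.speed, Measure.ae_ne volume l,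
    (measurePreserving_sub_right volume l).quasiMeasurePreserving.ae h₂.speed] with t ht₁ htl ht₂
  rcases lt_or_gt_of_ne htl with h | h
  · have heq : (fun s => (concatCurve l γ₁ γ₂ s).val) =ᶠ[𝓝 t] fun s => (γ₁ s).val := by
      filter_upwards [Iio_mem_nhds h] with s hs
      rw [concatCurve_of_le (le_of_lt hs)]
    rwa [heq.deriv_eq, concatCurve_of_le h.le]
  · have heq : (fun s => (concatCurve l γ₁ γ₂ s).val) =ᶠ[𝓝 t]
        fun s => (γ₂ (s - l)).val := by
      filter_upwards [Ioi_mem_nhds h] with s hs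
      rw [concatCurve_of_ge hl (le_of_lt hs)]
    rwa [heq.deriv_eq, concatCurve_of_ge hl h.le, deriv_comp_sub_const (fun s => (γ₂ s).val)]

lemma IsChainLength.exists_isSubunit {x y : KobayashiSpace M} {c : ℝ}
    (h : IsChainLength M x.val y.val c) :
    ∃ γ : ℝ → KobayashiSpace M, IsSubunit γ ∧ γ 0 = x ∧ γ c = y := by
  suffices ∃ γ : ℝ → KobayashiSpace M, IsSubunit γ ∧ γ 0 = x ∧ (γ c).val = y.val by
    simpa only [KobayashiSpace.ext_iff] using this
  refine IsChainLength.induction (P := fun y c => ∃ γ : ℝ → KobayashiSpace M,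
    IsSubunit γ ∧ γ 0 = x ∧ (γ c).val = y) ⟨_, isSubunit_const x, rfl, rfl⟩ ?_ h
  rintro y c φ a b hc ⟨γ, hγ, hγ0, hγc⟩ hφ ha hb rfl
  obtain ⟨ψ, hψ, hψa, hψb⟩ := hφ.exists_tanh_poincareDist ha hb
  have hjoin : γ c = ⟨ψ (Real.tanh 0), hψ.2 (ofReal_tanh_mem_unitDisc 0)⟩ :=
    KobayashiSpace.ext (by simp [hγc, hψa])
  refine ⟨_, hγ.concat hψ.isSubunit hjoin, ?_, ?_⟩
  · rw [concatCurve_of_le hc.nonneg, hγ0]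
  · rw [concatCurve_of_ge hjoin (le_add_of_nonneg_right (poincareDist_nonneg a b)),
      add_sub_cancel_left]
    exact hψb

lemma KobayashiSpace.exists_isSubunit {x y : KobayashiSpace M} {l : ℝ} (h : dist x y < l) :
    ∃ γ : ℝ → KobayashiSpace M, IsSubunit γ ∧ γ 0 = x ∧ γ l = y := by
  obtain ⟨c, hcl, hc⟩ := IsBoundedSubmanifold.isEmbedded.exists_isChainLength_lt
    IsBoundedSubmanifold.isConnected.isPreconnected x.mem y.mem h
  obtain ⟨γ, hγ, hγ0, hγc⟩ := IsChainLength.exists_isSubunit hc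
  refine ⟨_, hγ.concat (isSubunit_const y) hγc, ?_, ?_⟩
  · rw [concatCurve_of_le hc.nonneg, hγ0]
  · rw [concatCurve_of_ge hγc hcl.le]

lemma KobayashiSpace.isLengthSpace : IsLengthSpace (KobayashiSpace M) := fun _ _ _ hl =>
  let ⟨γ, hγ, hγ0, hγl⟩ := exists_isSubunit hl
  ⟨γ, hγ.lipschitzWith, hγ0, hγl⟩

lemma IsSubunit.isAlmostGeodesic {γ : ℝ → KobayashiSpace M} (hγ : IsSubunit γ) {l κ : ℝ}
    (hl0 : 0 ≤ l) (hκ : 0 ≤ κ) (hl : l ≤ dist (γ 0) (γ l) + κ) :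
    IsAlmostGeodesic M 1 κ 0 l fun t => (γ t).val where
  le := hl0
  mapsTo := fun t _ => (γ t).mem
  lower := fun s hs t ht => by
    rw [div_one, one_mul]
    exact abs_sub_sub_le_dist_of_lipschitzWith_one hγ.lipschitzWith hl ht hs
  upper := fun s _ t _ => by
    have hle := hγ.lipschitzWith.dist_le_mul t s
    rw [KobayashiSpace.dist_eq, NNReal.coe_one] at hle
    exact le_add_of_le_of_nonneg hle hκ
  absolutelyContinuous := by
    obtain ⟨C, hC⟩ := KobayashiSpace.exists_lipschitzWith_val (M := M)
    exact ((hC.comp hγ.lipschitzWith).lipschitzOnWith).absolutelyContinuousOnInterval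
  speed := by
    rw [ENNReal.ofReal_one]
    exact ae_restrict_of_ae hγ.speed

theorem joinedByAlmostGeodesics {κ : ℝ} (hκ : 0 < κ) : JoinedByAlmostGeodesics M 1 κ := by
  intro z hz w hw _
  let x : KobayashiSpace M := ⟨z, hz⟩
  let y : KobayashiSpace M := ⟨w, hw⟩
  obtain ⟨γ, hγ, hγ0, hγl⟩ := KobayashiSpace.exists_isSubunit (lt_add_of_pos_right (dist x y) hκ)
  exact ⟨0, dist x y + κ, fun t => (γ t).val,
    hγ.isAlmostGeodesic (by positivity) hκ.le (by rw [hγ0, hγl]),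
    congrArg KobayashiSpace.val hγ0, congrArg KobayashiSpace.val hγl⟩

theorem exists_isRealKobayashiGeodesic (hM : IsKobayashiComplete M) {z w : CSpace d} (hz : z ∈ M)
    (hw : w ∈ M) : ∃ (a b : ℝ) (σ : ℝ → CSpace d),
      IsRealKobayashiGeodesic M a b σ ∧ σ a = z ∧ σ b = w := by
  have := KobayashiSpace.completeSpace hM
  have := (KobayashiSpace.isLengthSpace (M := M)).properSpace
  let x : KobayashiSpace M := ⟨z, hz⟩
  let y : KobayashiSpace M := ⟨w, hw⟩
  obtain ⟨γ, hγ, hγ0, hγl⟩ := KobayashiSpace.isLengthSpace.exists_lipschitzWith_one x y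
  refine ⟨0, dist x y, fun t => (γ t).val,
    ⟨dist_nonneg, fun t _ => (γ t).mem, fun s hs t ht => ?_⟩,
    congrArg KobayashiSpace.val hγ0, congrArg KobayashiSpace.val hγl⟩
  have hle : dist (γ s) (γ t) ≤ |s - t| := by simpa [Real.dist_eq] using hγ.dist_le_mul s t
  have hge : |s - t| ≤ dist (γ s) (γ t) := by
    simpa using abs_sub_sub_le_dist_of_lipschitzWith_one hγ (κ := 0) (by simp [hγ0, hγl]) hs ht
  exact le_antisymm hge hle

end Subunit

end KobayashiSpace

section Visibility

variable {d : ℕ} {M : Set (CSpace d)} {δ a b : ℝ} {σ : ℝ → CSpace d}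

/-- A continuous curve in `M` along which the triangle inequality for `k_M` between the endpoints
is an equality up to the error `δ`. -/
structure IsAlmostMinimizing (M : Set (CSpace d)) (δ a b : ℝ) (σ : ℝ → CSpace d) : Prop where
  le : a ≤ b
  mapsTo : MapsTo σ (Icc a b) M
  continuousOn : ContinuousOn σ (Icc a b)
  add_le : ∀ t ∈ Icc a b, kobayashiDist M (σ a) (σ t) + kobayashiDist M (σ t) (σ b) ≤
    kobayashiDist M (σ a) (σ b) + δ

lemma IsAlmostGeodesic.isAlmostMinimizing {κ : ℝ} (h : IsAlmostGeodesic M 1 κ a b σ) :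
    IsAlmostMinimizing M (3 * κ) a b σ where
  le := h.le
  mapsTo := h.mapsTo
  continuousOn := uIcc_of_le h.le ▸ h.absolutelyContinuous.continuousOn
  add_le := fun t ht => by
    have hat := h.upper t ht a (left_mem_Icc.2 h.le)
    have htb := h.upper b (right_mem_Icc.2 h.le) t ht
    have hab := h.lower b (right_mem_Icc.2 h.le) a (left_mem_Icc.2 h.le)
    rw [abs_sub_comm, abs_of_nonneg (sub_nonneg.2 ht.1)] at hat
    rw [abs_sub_comm, abs_of_nonneg (sub_nonneg.2 ht.2)] at htb
    rw [abs_sub_comm, abs_of_nonneg (sub_nonneg.2 h.le)] at hab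
    linarith

variable [IsBoundedSubmanifold M]

lemma IsRealKobayashiGeodesic.isAlmostMinimizing (h : IsRealKobayashiGeodesic M a b σ) :
    IsAlmostMinimizing M 0 a b σ where
  le := h.le
  mapsTo := h.mapsTo
  continuousOn := by
    have hlip : LipschitzWith 1 fun t : Icc a b => (⟨σ t, h.mapsTo t.2⟩ : KobayashiSpace M) :=
      LipschitzWith.mk_one fun s t => (h.isometry s s.2 t t.2).ge
    exact continuousOn_iff_continuous_domRestrict.2
      (KobayashiSpace.isInducing_val.continuous.comp hlip.continuous)
  add_le := fun t ht => by
    rw [← h.isometry a (left_mem_Icc.2 h.le) t ht, ← h.isometry t ht b (right_mem_Icc.2 h.le),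
      ← h.isometry a (left_mem_Icc.2 h.le) b (right_mem_Icc.2 h.le), abs_sub_comm a t,
      abs_sub_comm t b, abs_sub_comm a b, abs_of_nonneg (sub_nonneg.2 ht.1),
      abs_of_nonneg (sub_nonneg.2 ht.2), abs_of_nonneg (sub_nonneg.2 h.le)]
    linarith

lemma IsAlmostMinimizing.exists_dist_le (h : IsAlmostMinimizing M δ a b σ)
    {o x y : KobayashiSpace M} (hx : σ a = x.val) (hy : σ b = y.val) {C : ℝ}
    (hC : ∀ z, min (gromovProduct o x z) (gromovProduct o z y) ≤ C) :
    ∃ t ∈ Icc a b, ∃ z : KobayashiSpace M, σ t = z.val ∧ dist o z ≤ 2 * C + δ := by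
  let τ : Icc a b → KobayashiSpace M := fun t => ⟨σ t, h.mapsTo t.2⟩
  have hτ : Continuous τ :=
    KobayashiSpace.isInducing_val.continuous_iff.2 h.continuousOn.domRestrict
  have : PreconnectedSpace (Icc a b) := Subtype.preconnectedSpace isPreconnected_Icc
  obtain rfl : τ ⟨a, left_mem_Icc.2 h.le⟩ = x := KobayashiSpace.ext hx
  obtain rfl : τ ⟨b, right_mem_Icc.2 h.le⟩ = y := KobayashiSpace.ext hy
  obtain ⟨t, ht⟩ := exists_dist_le_of_min_gromovProduct_le hτ (fun t => h.add_le t t.2)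
    (fun t => hC (τ t))
  exact ⟨t, t.2, τ t, rfl, ht⟩

variable {Γ : ℝ → ℝ → (ℝ → CSpace d) → Prop}

theorem BendsInside.hasBoundedGromovProduct (h : BendsInside M Γ)
    (hmin : ∀ a b σ, Γ a b σ → IsAlmostMinimizing M δ a b σ)
    (hjoin : ∀ z ∈ M, ∀ w ∈ M, z ≠ w → ∃ a b σ, Γ a b σ ∧ σ a = z ∧ σ b = w) :
    HasBoundedGromovProduct (KobayashiSpace.val : KobayashiSpace M → CSpace d) := by
  rw [HasBoundedGromovProduct, KobayashiSpace.range_val]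
  intro p hp q hq hpq o
  obtain ⟨V, hV, W, hW, K, hVW, hK, hKM, hbend⟩ := h p hp q hq hpq
  obtain ⟨R, hR⟩ := (KobayashiSpace.isInducing_val.isCompact_preimage' hK
    (hKM.trans_eq KobayashiSpace.range_val.symm)).isBounded.subset_closedBall o
  refine ⟨R + δ / 2, ?_⟩
  filter_upwards [prod_mem_prod (preimage_mem_comap hV) (preimage_mem_comap hW)]
    with ⟨x, y⟩ ⟨hxV, hyW⟩
  have hxy : x.val ≠ y.val := fun hxy =>
    hVW.le ⟨subset_closure hxV, hxy ▸ subset_closure hyW⟩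
  obtain ⟨a, b, σ, hσ, hσa, hσb⟩ := hjoin _ x.mem _ y.mem hxy
  obtain ⟨t, ht, htK⟩ := hbend a b σ hσ (hσa ▸ hxV) (hσb ▸ hyW)
  let z : KobayashiSpace M := ⟨σ t, hKM htK⟩
  have hz : dist o z ≤ R := Metric.mem_closedBall'.1 (hR htK)
  have hadd := (hmin a b σ hσ).add_le t ht
  rw [hσa, hσb] at hadd
  change dist x z + dist z y ≤ dist x y + δ at hadd
  exact (gromovProduct_le_of_add_le hadd).trans (add_le_add_left hz _)

theorem HasBoundedGromovProduct.bendsInside [ProperSpace (KobayashiSpace M)]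
    (h : HasBoundedGromovProduct (KobayashiSpace.val : KobayashiSpace M → CSpace d))
    (hmin : ∀ a b σ, Γ a b σ → IsAlmostMinimizing M δ a b σ) : BendsInside M Γ := by
  intro p hp q hq hpq
  obtain ⟨o⟩ : Nonempty (KobayashiSpace M) := inferInstance
  have hcompact : IsCompact (closure M) := IsBoundedSubmanifold.isBounded.isCompact_closure
  rw [← KobayashiSpace.range_val (M := M)] at hcompact hp hq
  obtain ⟨C, hC⟩ := h.eventually_forall_min_le KobayashiSpace.isInducing_val hcompact hp hq hpq o
  obtain ⟨P, hP, Q, hQ, hPQ⟩ := eventually_prod_iff.1 hC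
  obtain ⟨V, hV, hVP⟩ := (eventually_comap.1 hP).exists_mem
  obtain ⟨W, hW, hWQ⟩ := (eventually_comap.1 hQ).exists_mem
  obtain ⟨V', hpV', hV', W', hqW', hW', hdisj⟩ := exists_open_nhds_disjoint_closure hpq
  refine ⟨V ∩ V', inter_mem hV (hV'.mem_nhds hpV'), W ∩ W', inter_mem hW (hW'.mem_nhds hqW'),
    KobayashiSpace.val '' Metric.closedBall o (2 * C + δ),
    (hdisj.mono (closure_mono inter_subset_right) (closure_mono inter_subset_right)).inter_eq,
    (isCompact_closedBall o _).image KobayashiSpace.isInducing_val.continuous,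
    image_subset_iff.2 fun z _ => z.mem, fun a b σ hσ hσV hσW => ?_⟩
  have hσ := hmin a b σ hσ
  obtain ⟨t, ht, z, hz, hoz⟩ := hσ.exists_dist_le
    (x := ⟨σ a, hσ.mapsTo (left_mem_Icc.2 hσ.le)⟩) (y := ⟨σ b, hσ.mapsTo (right_mem_Icc.2 hσ.le)⟩)
    rfl rfl (hPQ (hVP _ hσV.1 _ rfl) (hWQ _ hσW.1 _ rfl))
  exact ⟨t, ht, z, Metric.mem_closedBall'.2 hoz, hz.symm⟩

end Visibility

theorem mainTheorem9 {d : ℕ} (M : Set (CSpace d))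
    (hM : IsEmbeddedComplexSubmanifold M) (hconn : IsConnected M)
    (hbdd : Bornology.IsBounded M) (hcomplete : IsKobayashiComplete M) :
    IsBNTVisibilitySubmanifold M ↔
      ∀ kap : ℝ, 0 ≤ kap → IsVisibilitySubmanifold M 1 kap := by
  have : IsBoundedSubmanifold M := ⟨hM, hconn, hbdd⟩
  have := KobayashiSpace.completeSpace hcomplete
  have := (KobayashiSpace.isLengthSpace (M := M)).properSpace
  have hgeo : ∀ a b σ, IsRealKobayashiGeodesic M a b σ → IsAlmostMinimizing M 0 a b σ :=
    fun _ _ _ hσ => hσ.isAlmostMinimizing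
  have halmost : ∀ κ a b σ, IsAlmostGeodesic M 1 κ a b σ → IsAlmostMinimizing M (3 * κ) a b σ :=
    fun _ _ _ _ hσ => hσ.isAlmostMinimizing
  constructor
  · rintro ⟨-, hvis⟩ κ -
    have hbound := hvis.hasBoundedGromovProduct hgeo
      fun z hz w hw _ => exists_isRealKobayashiGeodesic hcomplete hz hw
    exact ⟨joinedByAlmostGeodesics, hbound.bendsInside (halmost κ)⟩
  · intro hvis
    obtain ⟨hjoin, hbend⟩ := hvis 1 zero_le_one
    exact ⟨hcomplete, (hbend.hasBoundedGromovProduct (halmost 1) (hjoin one_pos)).bendsInside hgeo⟩
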